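/- Let $(R,\mathfrak m)$ be a commutative noetherian local ring and let $M$, $N$ be finitely generated $R$-modules such that $M$ has finite projective dimension $t=\operatorname{pd}_R M\ge 1$. For a finitely generated $R$-module $L$ let $\operatorname{NF}(L)=\{\mathfrak p\in\operatorname{Spec}R : L_{\mathfrak p}\text{ is not flat (equivalently, not free) over }R_{\mathfrak p}\}$ be its non-free locus. Let $\operatorname{Syz}_0(M)=M$ and, for $i\ge 1$, let $\operatorname{Syz}_i(M)$ be an $i$-th syzygy module of $M$, i.e. the kernel of a surjection from a free module of finite rank onto $\operatorname{Syz}_{i-1}(M)$. Then, for every choice of $\operatorname{Syz}_{t-1}(M)$, $$\operatorname{Ass}_R\bigl(\operatorname{Tor}^R_t(M,N)\bigr)=\operatorname{Ass}_R(N)\cap \operatorname{NF}\bigl(\operatorname{Syz}_{t-1}(M)\bigr).$$ In particular, if $t=1$, then $$\operatorname{Ass}_R\bigl(\operatorname{Tor}^R_1(M,N)\bigr)=\operatorname{Ass}_R(N)\cap \operatorname{NF}(M).$$ -/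

import Mathlib

universe u

/-- The non-flat locus `NF(L)` of an `R`-module `L`: the primes `p` such that `L_p` is not flat
over `R_p`. For finitely generated `L` it is the non-free locus, see
`nonFreeLocus_eq_compl_freeLocus`. -/
def nonFreeLocus (R : Type u) [CommRing R] (L : Type u) [AddCommGroup L] [Module R L] :
    Set (PrimeSpectrum R) :=
  {p | ¬ Module.Flat (Localization.AtPrime p.asIdeal) (LocalizedModule p.asIdeal.primeCompl L)}

/-- For a finitely generated module, `NF(L)` is the set of primes at which `L` is not free. -/
theorem nonFreeLocus_eq_compl_freeLocus (R : Type u) [CommRing R]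
    (L : Type u) [AddCommGroup L] [Module R L] [Module.Finite R L] :
    nonFreeLocus R L = (Module.freeLocus R L)ᶜ := by
  ext p
  simp only [nonFreeLocus, Set.mem_ofPred_eq, Set.mem_compl_iff, Module.mem_freeLocus]
  refine not_congr ⟨fun h => ?_, fun h => inferInstance⟩
  exact Module.free_of_flat_of_isLocalRing

/-- `IsSyzygy R M n L` says that `L` is (isomorphic to) an `n`-th syzygy module of `M`, computed
from some resolution of `M` by free modules of finite rank:
a `0`-th syzygy of `M` is `M` itself, and an `(n+1)`-st syzygy of `M` is the kernel of a surjection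
from a free module of finite rank onto an `n`-th syzygy of `M`. The resolution may, but need not,
be minimal. -/
def IsSyzygy (R : Type u) [CommRing R] (M : Type u) [AddCommGroup M] [Module R M] :
    ℕ → ∀ (L : Type u) [AddCommGroup L] [Module R L], Prop
  | 0, L, _, _ => Nonempty (L ≃ₗ[R] M)
  | n + 1, L, _, _ =>
      ∃ (K : Type u) (_ : AddCommGroup K) (_ : Module R K) (m : ℕ) (f : (Fin m → R) →ₗ[R] K),
        IsSyzygy R M n K ∧ Function.Surjective f ∧ Nonempty (L ≃ₗ[R] LinearMap.ker f)

/-- Syzygies of all orders of a finitely generated module over a noetherian ring exist, and they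
are finitely generated. -/
theorem exists_isSyzygy (R : Type u) [CommRing R] [IsNoetherianRing R]
    (M : Type u) [AddCommGroup M] [Module R M] [Module.Finite R M] (n : ℕ) :
    ∃ (L : Type u) (_ : AddCommGroup L) (_ : Module R L), Module.Finite R L ∧ IsSyzygy R M n L := by
  induction n with
  | zero => exact ⟨M, inferInstance, inferInstance, inferInstance, ⟨LinearEquiv.refl R M⟩⟩
  | succ n ih =>
    obtain ⟨K, iK, jK, hK, hs⟩ := ih
    obtain ⟨m, f, hf⟩ := Module.Finite.exists_fin' R K
    exact ⟨LinearMap.ker f, inferInstance, inferInstance, inferInstance,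
      ⟨K, iK, jK, m, f, hs, hf, ⟨LinearEquiv.refl R _⟩⟩⟩

/-- `Tor_n^R(M, N)`, as an `R`-module: the `n`-th homology of `P ⊗ N` for a projective
resolution `P` of `M`. -/
noncomputable abbrev TorModule (R : Type u) [CommRing R] (n : ℕ)
    (M : Type u) [AddCommGroup M] [Module R M] (N : Type u) [AddCommGroup N] [Module R N] :
    ModuleCat.{u} R :=
  ((CategoryTheory.Tor' (ModuleCat.{u} R) n).obj (ModuleCat.of R M)).obj (ModuleCat.of R N)

/-! Dimension shifting gives `Tor_t(M,N) ≅ Tor_1(L,N)` for `L = Syz_{t-1}(M)`, and `pd L ≤ 1`. Over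
a local ring `L` then has a free resolution `0 → G → F → L → 0` of finite rank, so `Tor_1(L,N)` is
the kernel of `G ⊗ N → F ⊗ N`. This kernel lies in `G ⊗ N ≅ N^r`, so its associated primes belong to
`Ass N`; it vanishes at every prime where `L` is flat, so they also belong to `NF(L)`. Conversely,
`p ∈ Ass N` embeds `R/p` in `N`, hence `K = ker(G ⊗ R/p → F ⊗ R/p)` in the Tor. If `K = 0`, then `G
→ F` stays injective over the residue field at `p`, which makes `L_p` free. So for `p ∈ NF(L)` we
have `K ≠ 0`, and `p` is its only associated prime because `K` lies in `(R/p)^r`. -/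

namespace CategoryTheory

/-! ### Splicing projective resolutions; dimension shifting -/

variable {C : Type*} [Category* C] [Abelian C]

namespace ProjectiveResolution

/-- The augmentation `P₀ ⟶ Z` of a projective resolution of `Z`. -/
noncomputable def augmentation {Z : C} (P : ProjectiveResolution Z) : P.complex.X 0 ⟶ Z :=
  P.π.f 0

instance {Z : C} (P : ProjectiveResolution Z) : Epi P.augmentation :=
  inferInstanceAs (Epi (P.π.f 0))

lemma complex_d_comp_augmentation {Z : C} (P : ProjectiveResolution Z) :
    P.complex.d 1 0 ≫ P.augmentation = 0 :=
  P.complex_d_comp_π_f_zero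

/-- The beginning `P₁ ⟶ P₀ ⟶ Z` of a projective resolution is exact. -/
lemma exact_zero {Z : C} (P : ProjectiveResolution Z) :
    (ShortComplex.mk (P.complex.d 1 0) P.augmentation P.complex_d_comp_augmentation).Exact :=
  ShortComplex.exact_of_g_is_cokernel _ P.isColimitCokernelCofork

/-- The complex obtained by splicing a projective resolution of the first object of a short
complex with the first map of this short complex. -/
noncomputable def spliceComplex {S : ShortComplex C} (P : ProjectiveResolution S.X₁) :
    ChainComplex C ℕ :=
  P.complex.augment (P.augmentation ≫ S.f) (by
    rw [← Category.assoc, complex_d_comp_augmentation, Limits.zero_comp])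

/-- Composing the augmentation with the monomorphism `S.f` leaves its kernel unchanged; higher
degrees are those of `P`, shifted by one. -/
lemma spliceComplex_exactAt_succ {S : ShortComplex C} (hS : S.ShortExact)
    (P : ProjectiveResolution S.X₁) (n : ℕ) : P.spliceComplex.ExactAt (n + 1) := by
  rw [HomologicalComplex.exactAt_iff' _ (n + 2) (n + 1) n (by simp) (by simp)]
  match n with
  | 0 =>
    let T : ShortComplex C := ShortComplex.mk (P.complex.d 1 0) (P.augmentation ≫ S.f)
      (by rw [← Category.assoc, complex_d_comp_augmentation, Limits.zero_comp])
    let φ : ShortComplex.mk _ _ P.complex_d_comp_augmentation ⟶ T :=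
      { τ₁ := 𝟙 _, τ₂ := 𝟙 _, τ₃ := S.f }
    have : Epi φ.τ₁ := inferInstanceAs (Epi (𝟙 _))
    have : IsIso φ.τ₂ := inferInstanceAs (IsIso (𝟙 _))
    have : Mono φ.τ₃ := hS.mono_f
    exact (ShortComplex.exact_iff_of_epi_of_isIso_of_mono φ).1 P.exact_zero
  | n + 1 => exact P.exact_succ n

/-- Splicing a projective resolution of the kernel of an epimorphism from a projective object
yields a projective resolution of the target. -/
noncomputable def splice {S : ShortComplex C} (hS : S.ShortExact) [Projective S.X₂]
    (P : ProjectiveResolution S.X₁) : ProjectiveResolution S.X₃ where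
  complex := P.spliceComplex
  projective
    | 0 => inferInstanceAs (Projective S.X₂)
    | n + 1 => P.projective n
  π := (ChainComplex.toSingle₀Equiv _ _).symm ⟨S.g, by
    change (P.augmentation ≫ S.f) ≫ S.g = 0
    rw [Category.assoc, S.zero, Limits.comp_zero]⟩
  quasiIso := ⟨fun n => by
    cases n with
    | zero =>
      rw [ChainComplex.quasiIsoAt₀_iff, ShortComplex.quasiIso_iff_of_zeros']
      · let T : ShortComplex C := ShortComplex.mk (P.augmentation ≫ S.f) S.g
          (by rw [Category.assoc, S.zero, Limits.comp_zero])
        -- The augmentation is epi, so precomposing with it does not change the image of `S.f`.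
        let φ : T ⟶ S := { τ₁ := P.augmentation, τ₂ := 𝟙 _, τ₃ := 𝟙 _ }
        have : Epi φ.τ₁ := inferInstanceAs (Epi P.augmentation)
        have : IsIso φ.τ₂ := inferInstanceAs (IsIso (𝟙 _))
        have : Mono φ.τ₃ := inferInstanceAs (Mono (𝟙 _))
        have hT : T.Exact ∧ Epi T.g :=
          ⟨(ShortComplex.exact_iff_of_epi_of_isIso_of_mono φ).2 hS.exact, hS.epi_g⟩
        refine (ShortComplex.exact_and_epi_g_iff_of_iso ?_).2 hT
        refine ShortComplex.isoMk (Iso.refl _) (Iso.refl _) (Iso.refl _) ?_ ?_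
        · exact (Category.id_comp _).trans (Category.comp_id _).symm
        · refine (Category.id_comp _).trans (Eq.trans ?_ (Category.comp_id _).symm)
          exact (ChainComplex.toSingle₀Equiv_symm_apply_f_zero (C := P.spliceComplex) S.g _).symm
      all_goals rfl
    | succ n =>
      rw [quasiIsoAt_iff_exactAt']
      · exact spliceComplex_exactAt_succ hS P n
      · apply ChainComplex.exactAt_succ_single_obj⟩

end ProjectiveResolution

variable {D : Type*} [Category* D] [Abelian D] [HasProjectiveResolutions C]

/-- Dimension shifting for left derived functors. -/
noncomputable def Functor.leftDerivedSuccSuccIso (F : C ⥤ D) [F.Additive] {S : ShortComplex C}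
    (hS : S.ShortExact) [Projective S.X₂] (n : ℕ) :
    (F.leftDerived (n + 2)).obj S.X₃ ≅ (F.leftDerived (n + 1)).obj S.X₁ :=
  let P := projectiveResolution S.X₁
  (P.splice hS).isoLeftDerivedObj F (n + 2) ≪≫
    HomologicalComplex.homologyIsoSc' _ (n + 3) (n + 2) (n + 1) (by simp) (by simp) ≪≫
    ShortComplex.homologyMapIso (ShortComplex.isoMk (Iso.refl _) (Iso.refl _) (Iso.refl _)
      ((Category.id_comp _).trans (Category.comp_id _).symm)
      ((Category.id_comp _).trans (Category.comp_id _).symm)) ≪≫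
    (HomologicalComplex.homologyIsoSc' ((F.mapHomologicalComplex _).obj P.complex)
      (n + 2) (n + 1) n (by simp) (by simp)).symm ≪≫
    (P.isoLeftDerivedObj F (n + 1)).symm

/-- The first left derived functor of an object with a projective resolution of length one. -/
noncomputable def Functor.leftDerivedOneIsoKernel (F : C ⥤ D) [F.Additive] {S : ShortComplex C}
    (hS : S.ShortExact) [Projective S.X₁] [Projective S.X₂] :
    (F.leftDerived 1).obj S.X₃ ≅ Limits.kernel (F.map S.f) :=
  let P := ProjectiveResolution.self S.X₁
  let T : ShortComplex D := ShortComplex.mk (0 : F.obj (P.complex.X 1) ⟶ F.obj S.X₁) (F.map S.f)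
    Limits.zero_comp
  -- The resolution of the projective `S.X₁` is concentrated in degree 0, so the spliced one
  -- vanishes in degree 2.
  have hP : Limits.IsZero (F.obj (P.complex.X 1)) :=
    F.map_isZero (HomologicalComplex.isZero_single_obj_X _ _ _ _ one_ne_zero)
  let e : ((F.mapHomologicalComplex _).obj (P.splice hS).complex).sc' 2 1 0 ≅ T :=
    ShortComplex.isoMk (Iso.refl _) (Iso.refl (F.obj S.X₁)) (Iso.refl _) (hP.eq_of_src _ _) (by
      refine (Category.id_comp _).trans (Eq.trans ?_ (Category.comp_id _).symm)
      exact congrArg F.map (Category.id_comp S.f).symm)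
  (P.splice hS).isoLeftDerivedObj F 1 ≪≫
    HomologicalComplex.homologyIsoSc' _ 2 1 0 (by simp) (by simp) ≪≫
    ShortComplex.homologyMapIso e ≪≫
    (ShortComplex.LeftHomologyData.ofIsLimitKernelFork T rfl _
      (Limits.kernelIsKernel (F.map S.f))).homologyIso

end CategoryTheory

open CategoryTheory
open scoped TensorProduct

/-! ### Injectivity after tensoring -/

section TensorInjective

variable {R : Type*} [CommRing R] {G F L N : Type*} [AddCommGroup G] [Module R G]
  [AddCommGroup F] [Module R F] [AddCommGroup L] [Module R L] [AddCommGroup N] [Module R N]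

/-- An injective linear map with flat cokernel stays injective after tensoring. -/
lemma LinearMap.rTensor_injective_of_flat_of_exact [Module.Flat R L] {f : G →ₗ[R] F}
    {g : F →ₗ[R] L} (hf : Function.Injective f) (hfg : Function.Exact f g)
    (hg : Function.Surjective g) (N : Type*) [AddCommGroup N] [Module R N] :
    Function.Injective (f.rTensor N) := by
  rw [← LinearMap.lTensor_inj_iff_rTensor_inj]
  -- Present `N` as a quotient of a free module and chase the diagram: flatness of `L` handles the
  -- relations, freeness handles `f`.
  have hπ := Finsupp.linearCombination_id_surjective R N
  exact lTensor_injective_of_exact_of_exact_of_rTensor_injective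
    (LinearMap.exact_subtype_ker_map _) hπ hfg hg
    (Module.Flat.rTensor_preserves_injective_linearMap _ (Submodule.subtype_injective _))
    (Module.Flat.lTensor_preserves_injective_linearMap _ hf)

/-- Base change in stages, for injectivity of tensored maps. -/
lemma LinearMap.lTensor_baseChange_injective_iff (A B : Type*) [CommRing A] [Algebra R A]
    [CommRing B] [Algebra R B] [Algebra A B] [IsScalarTower R A B] (f : G →ₗ[R] F) :
    Function.Injective ((f.baseChange A).lTensor B) ↔ Function.Injective (f.lTensor B) := by
  let eG := TensorProduct.AlgebraTensorModule.cancelBaseChange R A A B G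
  let eF := TensorProduct.AlgebraTensorModule.cancelBaseChange R A A B F
  have h (x : B ⊗[A] (A ⊗[R] G)) : eF ((f.baseChange A).lTensor B x) = f.lTensor B (eG x) := by
    induction x with
    | zero => simp
    | add x y hx hy => simp only [map_add, hx, hy]
    | tmul b y =>
      induction y with
      | zero => simp
      | add x y hx hy => simp only [TensorProduct.tmul_add, map_add, hx, hy]
      | tmul a g => simp [eG, eF]
  have h' : eF ∘ (f.baseChange A).lTensor B = f.lTensor B ∘ eG := funext h
  rw [← eF.injective.of_comp_iff, h', Function.Injective.of_comp_iff' _ eG.bijective]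

end TensorInjective

/-! ### Associated primes of finite powers -/

section AssociatedPrimes

variable {R : Type*} [CommRing R] [IsNoetherianRing R]

/-- The annihilator of a tuple is the finite intersection of those of its coordinates; if it is
prime, it equals one of them. -/
lemma associatedPrimes_pi_const_subset (ι : Type*) [Finite ι] (N : Type*) [AddCommGroup N]
    [Module R N] : associatedPrimes R (ι → N) ⊆ associatedPrimes R N := by
  intro p hp
  have := Fintype.ofFinite ι
  rw [AssociatedPrimes.mem_iff, isAssociatedPrime_iff] at hp ⊢
  obtain ⟨hp, x, hx⟩ := hp
  have h : p = Finset.univ.inf fun i => (⊥ : Submodule R N).colon {x i} := by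
    rw [hx]
    ext r
    simp [Submodule.mem_colon_singleton, Submodule.mem_finsetInf, funext_iff]
  obtain ⟨i, -, hi⟩ := Ideal.eq_inf_of_isPrime_inf (h ▸ hp)
  exact ⟨hp, x i, h.trans hi.symm⟩

lemma associatedPrimes_tensorProduct_subset (G N : Type*) [AddCommGroup G] [Module R G]
    [AddCommGroup N] [Module R N] [Module.Finite R G] [Module.Free R G] :
    associatedPrimes R (G ⊗[R] N) ⊆ associatedPrimes R N := by
  classical
  let e : G ⊗[R] N ≃ₗ[R] (Module.Free.ChooseBasisIndex R G → N) :=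
    (TensorProduct.congr (Module.Free.chooseBasis R G).equivFun (LinearEquiv.refl R N)).trans
      ((TensorProduct.comm R _ N).trans (TensorProduct.piScalarRight R R N _))
  rw [LinearEquiv.AssociatedPrimes.eq e]
  exact associatedPrimes_pi_const_subset _ N

end AssociatedPrimes

/-! ### Resolutions of length one and the non-free locus -/

section NonFreeLocus

variable {R : Type u} [CommRing R] {G F L : Type u} [AddCommGroup G] [Module R G]
  [AddCommGroup F] [Module R F] [AddCommGroup L] [Module R L]

lemma mem_nonFreeLocus_iff_tensorProduct (p : PrimeSpectrum R) :
    p ∈ nonFreeLocus R L ↔ ¬ Module.Flat (Localization.AtPrime p.asIdeal)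
      (Localization.AtPrime p.asIdeal ⊗[R] L) :=
  not_congr (Module.Flat.equiv_iff (LocalizedModule.equivTensorProduct p.asIdeal.primeCompl L))

lemma nonFreeLocus_congr {L' : Type u} [AddCommGroup L'] [Module R L'] (e : L ≃ₗ[R] L') :
    nonFreeLocus R L = nonFreeLocus R L' := by
  ext p
  rw [mem_nonFreeLocus_iff_tensorProduct, mem_nonFreeLocus_iff_tensorProduct,
    Module.Flat.equiv_iff (e.baseChange R (Localization.AtPrime p.asIdeal) L L')]

/-- If `f` stays injective modulo the prime `p`, then its cokernel is free at `p`. -/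
lemma notMem_nonFreeLocus_of_rTensor_injective [Module.Finite R G] [Module.Finite R F]
    [Module.Free R F] {f : G →ₗ[R] F} {g : F →ₗ[R] L} (hfg : Function.Exact f g)
    (hg : Function.Surjective g) (p : PrimeSpectrum R)
    (h : Function.Injective (f.rTensor (R ⧸ p.asIdeal))) : p ∉ nonFreeLocus R L := by
  rw [mem_nonFreeLocus_iff_tensorProduct, not_not]
  let A := Localization.AtPrime p.asIdeal
  let k := IsLocalRing.ResidueField A
  -- `k` is the fraction field of `R/p`, so injectivity over `R/p` passes to `k`.
  have : Module.Flat (R ⧸ p.asIdeal) k :=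
    IsLocalization.flat k (nonZeroDivisors (R ⧸ p.asIdeal))
  rw [← LinearMap.lTensor_inj_iff_rTensor_inj] at h
  have h₁ : Function.Injective (f.lTensor k) :=
    (LinearMap.lTensor_baseChange_injective_iff (R ⧸ p.asIdeal) k f).1
      (Module.Flat.lTensor_preserves_injective_linearMap (f.baseChange (R ⧸ p.asIdeal)) h)
  have : Module.Free A (A ⊗[R] L) :=
    Module.free_of_lTensor_residueField_injective (f.baseChange A) (g.baseChange A)
      (LinearMap.lTensor_surjective A hg) (lTensor_exact A hfg hg)
      ((LinearMap.lTensor_baseChange_injective_iff A k f).2 h₁)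
  infer_instance

variable [IsNoetherianRing R]

/-- If `L_p` were flat, the kernel would vanish at `p`, and an element with annihilator `p` would be
killed by some `s ∉ p`. -/
lemma mem_nonFreeLocus_of_isAssociatedPrime_ker {f : G →ₗ[R] F} {g : F →ₗ[R] L}
    (hf : Function.Injective f) (hfg : Function.Exact f g) (hg : Function.Surjective g)
    {N : Type u} [AddCommGroup N] [Module R N] (p : PrimeSpectrum R)
    (hp : IsAssociatedPrime p.asIdeal (LinearMap.ker (f.rTensor N))) : p ∈ nonFreeLocus R L := by
  rw [mem_nonFreeLocus_iff_tensorProduct]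
  intro hL
  let A := Localization.AtPrime p.asIdeal
  obtain ⟨-, x, hx⟩ := isAssociatedPrime_iff.1 hp
  have : Module.Flat R (A ⊗[R] L) := Module.Flat.trans R A (A ⊗[R] L)
  have hinj : Function.Injective ((f.lTensor A).rTensor N) :=
    LinearMap.rTensor_injective_of_flat_of_exact (g := g.lTensor A)
      (Module.Flat.lTensor_preserves_injective_linearMap f hf) (lTensor_exact A hfg hg)
      (LinearMap.lTensor_surjective A hg) N
  have hloc : IsLocalizedModule p.asIdeal.primeCompl
      ((TensorProduct.mk R A G 1).rTensor N) :=
    IsLocalizedModule.rTensor R p.asIdeal.primeCompl (g := TensorProduct.mk R A G 1)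
  have hcomm : (f.lTensor A).rTensor N ∘ₗ (TensorProduct.mk R A G 1).rTensor N =
      (TensorProduct.mk R A F 1).rTensor N ∘ₗ f.rTensor N := by
    rw [← LinearMap.rTensor_comp, ← LinearMap.rTensor_comp]
    congr 1
  have hzero : (TensorProduct.mk R A G 1).rTensor N (x : G ⊗[R] N) = 0 := by
    apply hinj
    rw [map_zero]
    refine (LinearMap.congr_fun hcomm _).trans ?_
    rw [LinearMap.comp_apply, LinearMap.mem_ker.1 x.2, map_zero]
  obtain ⟨s, hs⟩ := (IsLocalizedModule.eq_zero_iff p.asIdeal.primeCompl _).1 hzero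
  refine s.2 ?_
  refine hx.ge (Submodule.mem_colon_singleton.2 ?_)
  exact (Submodule.mem_bot R).2 (Subtype.ext hs)

/-- An embedding of `R/p` into `N` reduces the claim to `N = R/p`, since `G` is flat. -/
lemma isAssociatedPrime_ker_of_mem_nonFreeLocus [Module.Finite R G] [Module.Free R G]
    [Module.Finite R F] [Module.Free R F] {f : G →ₗ[R] F} {g : F →ₗ[R] L}
    (hfg : Function.Exact f g) (hg : Function.Surjective g)
    {N : Type u} [AddCommGroup N] [Module R N] (p : PrimeSpectrum R)
    (hpN : IsAssociatedPrime p.asIdeal N) (hpL : p ∈ nonFreeLocus R L) :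
    IsAssociatedPrime p.asIdeal (LinearMap.ker (f.rTensor N)) := by
  obtain ⟨-, i, hi⟩ := (isAssociatedPrime_iff_exists_injective_linearMap _ _).1 hpN
  let K := LinearMap.ker (f.rTensor (R ⧸ p.asIdeal))
  have hK : Nontrivial K := by
    rw [Submodule.nontrivial_iff_ne_bot]
    exact fun h => notMem_nonFreeLocus_of_rTensor_injective hfg hg p (LinearMap.ker_eq_bot.1 h) hpL
  -- `K` sits in a finite power of `R/p`, whose only possible associated prime is `p`.
  obtain ⟨q, hq⟩ := associatedPrimes.nonempty R K
  have hqp : q = p.asIdeal := by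
    have := associatedPrimes_tensorProduct_subset G (R ⧸ p.asIdeal)
      (associatedPrimes.subset_of_injective K.subtype_injective hq)
    simpa [associatedPrimes.eq_singleton_of_isPrimary p.isPrime.isPrimary,
      p.isPrime.radical] using this
  let j : K →ₗ[R] LinearMap.ker (f.rTensor N) := (i.lTensor G).restrict fun x hx => by
    rw [LinearMap.mem_ker] at hx ⊢
    have h := LinearMap.congr_fun
      ((LinearMap.rTensor_comp_lTensor _ f i).trans (LinearMap.lTensor_comp_rTensor _ f i).symm) x
    exact h.trans (by rw [LinearMap.comp_apply, hx, map_zero])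
  have hj : Function.Injective j := fun x y hxy => Subtype.ext
    (Module.Flat.lTensor_preserves_injective_linearMap i hi (congrArg Subtype.val hxy))
  exact hqp ▸ associatedPrimes.subset_of_injective hj hq

/-- The associated primes of the kernel of `G ⊗ N → F ⊗ N`, for a free resolution
`0 → G → F → L → 0` of length one by modules of finite rank. -/
lemma associatedPrimes_ker_rTensor [Module.Finite R G] [Module.Free R G]
    [Module.Finite R F] [Module.Free R F] {f : G →ₗ[R] F} {g : F →ₗ[R] L}
    (hf : Function.Injective f) (hfg : Function.Exact f g) (hg : Function.Surjective g)
    (N : Type u) [AddCommGroup N] [Module R N] :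
    associatedPrimes R (LinearMap.ker (f.rTensor N)) =
      associatedPrimes R N ∩ PrimeSpectrum.asIdeal '' nonFreeLocus R L := by
  ext p
  constructor
  · intro hp
    exact ⟨associatedPrimes_tensorProduct_subset G N
      (associatedPrimes.subset_of_injective (Submodule.subtype_injective _) hp),
      ⟨p, hp.isPrime⟩, mem_nonFreeLocus_of_isAssociatedPrime_ker hf hfg hg _ hp, rfl⟩
  · rintro ⟨hpN, p, hpL, rfl⟩
    exact isAssociatedPrime_ker_of_mem_nonFreeLocus hfg hg p hpN hpL

end NonFreeLocus

/-! ### Reduction to the first Tor -/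

section Syzygies

variable {R : Type u} [CommRing R]

instance (m : ℕ) : Projective (ModuleCat.of R (Fin m → R)) :=
  (IsProjective.iff_projective (Fin m → R)).1 inferInstance

/-- Passing to a syzygy shifts `Tor` and the projective dimension. -/
lemma IsSyzygy.tor_iso_and_hasProjectiveDimensionLT [IsNoetherianRing R]
    {M : Type u} [AddCommGroup M] [Module R M] [Module.Finite R M]
    (N : Type u) [AddCommGroup N] [Module R N] (n k : ℕ)
    (L : Type u) [AddCommGroup L] [Module R L] (h : IsSyzygy R M n L) :
    Nonempty (TorModule R (n + k + 1) M N ≅ TorModule R (k + 1) L N) ∧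
    (HasProjectiveDimensionLT (ModuleCat.of R M) (n + k + 1) →
      HasProjectiveDimensionLT (ModuleCat.of R L) (k + 1)) ∧ Module.Finite R L := by
  induction n generalizing k L with
  | zero =>
    obtain ⟨e⟩ := h
    rw [zero_add]
    refine ⟨⟨(((Tor' (ModuleCat.{u} R) (k + 1)).mapIso e.symm.toModuleIso).app _)⟩, fun _ =>
      hasProjectiveDimensionLT_of_iso e.symm.toModuleIso _, Module.Finite.equiv e.symm⟩
  | succ n ih =>
    obtain ⟨K, _, _, m, f, hK, hf, ⟨e⟩⟩ := h
    obtain ⟨⟨t⟩, hdim, hfin⟩ := ih (k + 1) K hK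
    have hS := LinearMap.shortExact_shortComplexKer hf
    have : Projective f.shortComplexKer.X₂ :=
      inferInstanceAs (Projective (ModuleCat.of R (Fin m → R)))
    have hn : n + 1 + k + 1 = n + (k + 1) + 1 := by omega
    rw [hn]
    refine ⟨⟨t ≪≫ ((MonoidalCategory.tensoringRight (ModuleCat.{u} R)).obj
      (ModuleCat.of R N)).leftDerivedSuccSuccIso hS k ≪≫
      (((Tor' (ModuleCat.{u} R) (k + 1)).mapIso e.symm.toModuleIso).app _)⟩, fun hM => ?_,
      Module.Finite.equiv e.symm⟩
    have := (hS.hasProjectiveDimensionLT_X₃_iff k inferInstance).1 (hdim hM)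
    exact @hasProjectiveDimensionLT_of_iso _ _ _ _ _ e.symm.toModuleIso _ this

/-- The associated primes of `Tor₁(L, N)` for `L` of projective dimension at most one. -/
lemma associatedPrimes_tor_one [IsLocalRing R] [IsNoetherianRing R]
    (L : Type u) [AddCommGroup L] [Module R L] [Module.Finite R L]
    (N : Type u) [AddCommGroup N] [Module R N]
    (hL : HasProjectiveDimensionLT (ModuleCat.of R L) 2) :
    associatedPrimes R (TorModule R 1 L N) =
      associatedPrimes R N ∩ PrimeSpectrum.asIdeal '' nonFreeLocus R L := by
  obtain ⟨m, f, hf⟩ := Module.Finite.exists_fin' R L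
  have hS := LinearMap.shortExact_shortComplexKer hf
  have : Projective f.shortComplexKer.X₂ :=
    inferInstanceAs (Projective (ModuleCat.of R (Fin m → R)))
  have hker : Projective f.shortComplexKer.X₁ :=
    projective_iff_hasProjectiveDimensionLT_one.2
      ((hS.hasProjectiveDimensionLT_X₃_iff 0 inferInstance).1 hL)
  have : Module.Projective R (LinearMap.ker f) := (IsProjective.iff_projective _).2 hker
  have : Module.Free R (LinearMap.ker f) := Module.free_of_flat_of_isLocalRing
  rw [← associatedPrimes_ker_rTensor (LinearMap.ker f).subtype_injective
    (LinearMap.exact_subtype_ker_map f) hf N]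
  exact LinearEquiv.AssociatedPrimes.eq
    (((MonoidalCategory.tensoringRight (ModuleCat.{u} R)).obj
      (ModuleCat.of R N)).leftDerivedOneIsoKernel hS ≪≫ ModuleCat.kernelIsoKer _).toLinearEquiv

end Syzygies

theorem mainTheorem9 (R : Type u) [CommRing R] [IsLocalRing R] [IsNoetherianRing R]
    (M : Type u) [AddCommGroup M] [Module R M] [Module.Finite R M]
    (N : Type u) [AddCommGroup N] [Module R N] [Module.Finite R N]
    (t : ℕ) (ht : 1 ≤ t)
    (hpd : CategoryTheory.projectiveDimension (ModuleCat.of R M) = (t : WithBot ℕ∞)) :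
    (∀ (L : Type u) [AddCommGroup L] [Module R L], IsSyzygy R M (t - 1) L →
      associatedPrimes R (TorModule R t M N) =
        associatedPrimes R N ∩ PrimeSpectrum.asIdeal '' nonFreeLocus R L) ∧
    (t = 1 →
      associatedPrimes R (TorModule R 1 M N) =
        associatedPrimes R N ∩ PrimeSpectrum.asIdeal '' nonFreeLocus R M) := by
  obtain ⟨n, rfl⟩ : ∃ n, t = n + 1 := ⟨t - 1, by omega⟩
  have hM : HasProjectiveDimensionLT (ModuleCat.of R M) (n + 2) :=
    (projectiveDimension_le_iff _ (n + 1)).1 hpd.le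
  refine ⟨fun L _ _ hL => ?_, fun h => ?_⟩
  -- The shift is used twice: `k = 0` compares `Tor_{n+1}` with `Tor_1`, while `k = 1` turns `pd M <
  -- n + 2` into `pd L < 2`.
  · obtain ⟨⟨e⟩, -, hfin⟩ := hL.tor_iso_and_hasProjectiveDimensionLT N n 0 L
    have hdim := (hL.tor_iso_and_hasProjectiveDimensionLT N n 1 L).2.1 hM
    rw [← associatedPrimes_tor_one L N hdim]
    exact LinearEquiv.AssociatedPrimes.eq e.toLinearEquiv
  · obtain rfl : n = 0 := by omega
    exact associatedPrimes_tor_one M N hM
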